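/- Let $q \ge 2$ be real and let $q^*$ be its dual exponent, defined by $\frac1q + \frac1{q^*} = 1$. Let $p \ge 1$ be real and let $\mu_p$ be the probability measure $d\mu_p(x) = Z_p^{-1} e^{-|x|^p}\,dx$ on $\mathbb{R}$, where $Z_p = \int_{\mathbb{R}} e^{-|x|^p}\,dx$. Put $H_q(t) = \max(t^2, |t|^q)$ for $t \in \mathbb{R}$. For a probability measure $\mu$ on $\mathbb R$ and a measurable function $g \ge 0$, let $$\mathrm{Ent}_\mu(g) = \int g \log g \, d\mu - \Big(\int g\,d\mu\Big) \log\Big(\int g\,d\mu\Big) \in [0,+\infty],$$ with $0\log 0=0$ and with $\mathrm{Ent}_\mu(g) = +\infty$ if $\int g\,d\mu = +\infty$. Then there exists a constant $C_{p,q} \in (0,+\infty)$ such that every locally Lipschitz function $f : \mathbb{R} \to \mathbb{R}$ satisfies $$\mathrm{Ent}_{\mu_p}(f^2) \le C_{p,q} \int_{\mathbb{R}} H_q\Big(\frac{f'}{f}\Big) f^2 \, d\mu_p$$ if and only if $p \ge q^*$. Here $f'$ is the almost everywhere defined derivative of $f$, the integral on the right takes values in $[0,+\infty]$, and its integrand is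 $0$ where $f = 0$ (almost everywhere on that set $f' = 0$). -/

import Mathlib

open MeasureTheory
open scoped ENNReal

noncomputable section

/-- The function `H_q(t) = max (t ^ 2) (|t| ^ q)`. -/
def modPow (q t : ℝ) : ℝ := max (t ^ 2) (|t| ^ q)

/-- The normalising constant `Z_p = ∫ exp (-|x| ^ p) dx`. -/
def expPowConst (p : ℝ) : ℝ := ∫ x : ℝ, Real.exp (-|x| ^ p)

/-- The measure `dμ_p(x) = Z_p⁻¹ exp (-|x| ^ p) dx` on the real line. -/
def expPowMeasure (p : ℝ) : Measure ℝ :=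
  volume.withDensity fun x => ENNReal.ofReal ((expPowConst p)⁻¹ * Real.exp (-|x| ^ p))

open Classical in
/-- The entropy `∫ g log g dμ - (∫ g dμ) log (∫ g dμ)` of a nonnegative function `g` with respect
to a probability measure, as an extended number. When `g` is integrable, the negative part of
`g log g` is bounded by `1 / e`, so that `∫ g log g dμ` makes sense in `(-∞, +∞]`, as the difference
of the integrals of the positive and negative parts. When `∫ g dμ = +∞` the entropy is `+∞`. -/
def entropy (μ : Measure ℝ) (g : ℝ → ℝ) : EReal :=
  if Integrable g μ then
    ((∫⁻ x, ENNReal.ofReal (g x * Real.log (g x)) ∂μ : ℝ≥0∞) : EReal)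
      - ((∫⁻ x, ENNReal.ofReal (-(g x * Real.log (g x))) ∂μ : ℝ≥0∞) : EReal)
      - (((∫ x, g x ∂μ) * Real.log (∫ x, g x ∂μ) : ℝ) : EReal)
  else ⊤

/-- The `[0, +∞]`-valued energy `∫ H (f' / f) f ^ 2 dμ`. A locally Lipschitz `f` is differentiable
almost everywhere, with `f' = 0` almost everywhere on `{f = 0}`; the integrand is `0` there. -/
def modEnergy (H : ℝ → ℝ) (μ : Measure ℝ) (f : ℝ → ℝ) : ℝ≥0∞ :=
  ∫⁻ x, ENNReal.ofReal (H (deriv f x / f x) * f x ^ 2) ∂μ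

/-- The modified logarithmic Sobolev inequality with function `H`: for some finite constant `κ`,
every locally Lipschitz `f` satisfies `Ent_μ (f ^ 2) ≤ κ ∫ H (f' / f) f ^ 2 dμ`. -/
def ModifiedLogSobolev (H : ℝ → ℝ) (μ : Measure ℝ) : Prop :=
  ∃ κ : ℝ, 0 < κ ∧ ∀ f : ℝ → ℝ, LocallyLipschitz f →
    entropy μ (fun x => f x ^ 2) ≤ ((ENNReal.ofReal κ * modEnergy H μ f : ℝ≥0∞) : EReal)

end

/-! ### Locally Lipschitz functions, and passage from bounded intervals to the line. -/

section Calculus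

open Set Filter Topology

/-! Write `ρ` for the density and `s = q*`.

Sufficiency. Suppose `u ≥ 0` satisfies `a |u'| ≤ (a ^ s / s) u + K` for all `a ≥ 0`, a form of
Young's inequality that never divides by `u`. When `s ≤ p`, integrating `(x u ρ)'` bounds `∫ |x| ^ p
u dμ_p` by a multiple of `∫ u dμ_p + ∫ K dμ_p`. Hence `(u ρ)'` is integrable and `u ρ` is bounded,
so `log u ≤ |x| ^ p + const`. This gives a defective inequality `∫ u log u ≤ A (∫ u + ∫ K)` for mass
at most one (`exists_integral_mul_log_le`). To remove the defect, normalise `∫ f² dμ_p = 1` and take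
for `u` a smooth truncation of `f²` vanishing where `f² ≤ 4`. Its mass, and the part of `f² log f² -
f² + 1` that it misses, are `O((|f| - 1)²)` (`sq_mul_log_sq_le`). The Hardy inequality
`integral_sq_sub_le` with `t² ≤ H_q(t)` bounds `∫ (|f| - 1)²` by the energy. The truncation
satisfies the Young condition with `K` a multiple of `H_q(f'/f) f²`
(`mul_abs_deriv_smoothTrunc_le`).

Necessity. If `p < q*`, take `f` with `f² ρ` proportional to `x ^ (-(1 + p))` for `x > 1`. Then `f²
log f² ρ` decays like `1 / x`, so the entropy is infinite, while `f'/f` is of order `x ^ (p - 1)`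
and the energy is finite because `(p - 1) q < p`. -/

theorem LocallyLipschitz.absolutelyContinuousOnInterval {f : ℝ → ℝ} (hf : LocallyLipschitz f)
    (a b : ℝ) : AbsolutelyContinuousOnInterval f a b := by
  obtain ⟨K, hK⟩ := LocallyLipschitzOn.exists_lipschitzOnWith_of_compact
    (s := uIcc a b) isCompact_uIcc (hf.locallyLipschitzOn)
  exact hK.absolutelyContinuousOnInterval

theorem LocallyLipschitz.ae_differentiableAt {f : ℝ → ℝ} (hf : LocallyLipschitz f) :
    ∀ᵐ x, DifferentiableAt ℝ f x := by
  have h : ∀ n : ℕ, ∀ᵐ x, x ∈ uIcc (-(n : ℝ)) n → DifferentiableAt ℝ f x := fun n =>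
    (hf.absolutelyContinuousOnInterval _ _).ae_differentiableAt
  filter_upwards [ae_all_iff.2 h] with x hx
  obtain ⟨n, hn⟩ := exists_nat_ge |x|
  refine hx n ?_
  rw [uIcc_of_le (by linarith [abs_nonneg x])]
  exact abs_le.1 hn

/-- The derivative of any function vanishes almost everywhere on the zero set. -/
theorem ae_deriv_eq_zero_of_eq_zero (f : ℝ → ℝ) : ∀ᵐ x, f x = 0 → deriv f x = 0 := by
  -- A zero with nonzero derivative is isolated from the right in the zero set, and such points are
  -- countable.
  have hc := countable_setOfPred_isolated_right_within (s := {x : ℝ | f x = 0})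
  filter_upwards [hc.ae_notMem volume] with x hx hfx
  by_contra hd
  refine hx ⟨hfx, ?_⟩
  have h1 : ∀ᶠ z in 𝓝[≠] x, f z ≠ 0 :=
    ((differentiableAt_of_deriv_ne_zero hd).hasDerivAt.eventually_ne hd)
  rw [← eventually_false_iff_eq_bot]
  have h2 : 𝓝[{x | f x = 0} ∩ Ioi x] x ≤ 𝓝[≠] x :=
    nhdsWithin_mono _ fun y hy => (ne_of_gt hy.2 : y ≠ x)
  filter_upwards [h2 h1, self_mem_nhdsWithin] with z hz hz'
  exact hz hz'.1

/-- Integrations by parts on `[-R, R]` thus yield integrability and the bound together, with no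
decay assumed at infinity. -/
theorem integrable_and_integral_le_of_forall_symm {g : ℝ → ℝ} (hg : Continuous g)
    (h0 : ∀ x, 0 ≤ g x) {I : ℝ} (h : ∀ R : ℝ, 0 ≤ R → ∫ x in (-R)..R, g x ≤ I) :
    Integrable g ∧ ∫ x, g x ≤ I := by
  have hi : Integrable g := by
    refine integrable_of_intervalIntegral_norm_bounded (l := atTop) (a := fun R : ℝ => -R)
      (b := fun R => R) I (fun R => (hg.integrableOn_Ioc)) tendsto_neg_atTop_atBot tendsto_id ?_
    filter_upwards [eventually_ge_atTop 0] with R hR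
    simpa only [Real.norm_of_nonneg (h0 _)] using h R hR
  refine ⟨hi, le_of_tendsto (intervalIntegral_tendsto_integral (l := atTop) (a := fun R : ℝ => -R)
      (b := fun R => R) hi tendsto_neg_atTop_atBot tendsto_id) ?_⟩
  filter_upwards [eventually_ge_atTop 0] with R hR
  exact h R hR

end Calculus

/-! ### The density of `μ_p` and integration against it. -/

section Density

open Set Filter Topology

/-- The density of `expPowMeasure p`. -/
noncomputable def expPowDensity (p x : ℝ) : ℝ := (expPowConst p)⁻¹ * Real.exp (-|x| ^ p)

theorem integrable_exp_neg_abs_rpow {p : ℝ} (hp : 0 < p) :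
    Integrable fun x : ℝ => Real.exp (-|x| ^ p) := by
  refine Integrable.of_integral_ne_zero ?_
  rw [integral_comp_abs (f := fun x => Real.exp (-x ^ p)), integral_exp_neg_rpow hp]
  have := Real.Gamma_pos_of_pos (s := 1 / p + 1) (by positivity)
  positivity

theorem expPowConst_pos {p : ℝ} (hp : 0 < p) : 0 < expPowConst p := by
  have := integral_exp_pos (μ := volume) (integrable_exp_neg_abs_rpow hp)
  exact this

theorem expPowDensity_pos {p : ℝ} (hp : 0 < p) (x : ℝ) : 0 < expPowDensity p x :=
  mul_pos (inv_pos.2 (expPowConst_pos hp)) (Real.exp_pos _)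

theorem continuous_expPowDensity {p : ℝ} (hp : 0 ≤ p) : Continuous (expPowDensity p) := by
  unfold expPowDensity
  have : Continuous fun x : ℝ => |x| ^ p := continuous_abs.rpow_const fun _ => Or.inr hp
  fun_prop

theorem integrable_expPowDensity {p : ℝ} (hp : 0 < p) : Integrable (expPowDensity p) :=
  (integrable_exp_neg_abs_rpow hp).const_mul _

theorem integral_expPowDensity {p : ℝ} (hp : 0 < p) : ∫ x, expPowDensity p x = 1 := by
  unfold expPowDensity
  rw [integral_const_mul]
  exact inv_mul_cancel₀ (expPowConst_pos hp).ne'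

theorem expPowDensity_neg (p x : ℝ) : expPowDensity p (-x) = expPowDensity p x := by
  simp [expPowDensity]

theorem hasDerivAt_expPowDensity {p : ℝ} (hp : 1 < p) (x : ℝ) :
    HasDerivAt (expPowDensity p) (-(p * |x| ^ (p - 2) * x) * expPowDensity p x) x := by
  have := ((hasDerivAt_abs_rpow x hp).neg.exp).const_mul (expPowConst p)⁻¹
  convert! this using 1
  simp only [expPowDensity, Pi.neg_apply]; ring

theorem locallyLipschitz_expPowDensity {p : ℝ} (hp : 1 < p) :
    LocallyLipschitz (expPowDensity p) := by
  have : ContDiff ℝ 1 fun x : ℝ => |x| ^ p := by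
    simpa using contDiff_norm_rpow (E := ℝ) hp
  refine ContDiff.locallyLipschitz (𝕂 := ℝ) ?_
  unfold expPowDensity
  exact contDiff_const.mul this.neg.exp

theorem abs_rpow_sub_two_mul_sq {p : ℝ} (hp : 0 < p) (x : ℝ) :
    |x| ^ (p - 2) * x * x = |x| ^ p := by
  rcases eq_or_ne x 0 with rfl | hx
  · simp [hp.ne']
  · have hx' := abs_pos.2 hx
    rw [Real.rpow_sub hx', Real.rpow_two, mul_assoc, ← pow_two, sq_abs]
    field_simp

theorem expPowMeasure_eq (p : ℝ) : expPowMeasure p =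
    volume.withDensity fun x => ENNReal.ofReal (expPowDensity p x) := rfl

theorem integrable_expPowMeasure_iff {p : ℝ} (hp : 0 < p) {g : ℝ → ℝ} :
    Integrable g (expPowMeasure p) ↔ Integrable fun x => g x * expPowDensity p x := by
  rw [expPowMeasure_eq, integrable_withDensity_iff
    (continuous_expPowDensity hp.le).measurable.ennreal_ofReal (by simp)]
  simp only [ENNReal.toReal_ofReal (expPowDensity_pos hp _).le]

theorem integral_expPowMeasure {p : ℝ} (hp : 0 < p) (g : ℝ → ℝ) :
    ∫ x, g x ∂expPowMeasure p = ∫ x, g x * expPowDensity p x := by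
  rw [expPowMeasure_eq, integral_withDensity_eq_integral_toReal_smul
    (continuous_expPowDensity hp.le).measurable.ennreal_ofReal (by simp)]
  simp only [ENNReal.toReal_ofReal (expPowDensity_pos hp _).le, smul_eq_mul, mul_comm]

theorem isProbabilityMeasure_expPowMeasure {p : ℝ} (hp : 0 < p) :
    IsProbabilityMeasure (expPowMeasure p) := by
  constructor
  rw [expPowMeasure_eq, withDensity_apply _ MeasurableSet.univ, Measure.restrict_univ,
    ← ofReal_integral_eq_lintegral_ofReal (integrable_expPowDensity hp)
      (ae_of_all _ fun x => (expPowDensity_pos hp x).le), integral_expPowDensity hp,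
    ENNReal.ofReal_one]

end Density

/-! ### Hardy inequality centred at the origin. -/

section Hardy

open Set Filter Topology

/-- Superadditivity `(t + x) ^ p ≥ t ^ p + x ^ p`, valid for `p ≥ 1`, factors `exp (-x ^ p)` out of
the translated tail. -/
theorem setIntegral_Ioi_expPowDensity_le {p : ℝ} (hp : 1 ≤ p) {x : ℝ} (hx : 0 ≤ x) :
    ∫ t in Ioi x, expPowDensity p t ≤ expPowConst p * expPowDensity p x := by
  have hp0 : 0 < p := by linarith
  have hi := integrable_expPowDensity hp0
  have h1 : ∫ t in Ioi x, expPowDensity p t = ∫ t in Ioi 0, expPowDensity p (t + x) := by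
    have := (measurePreserving_add_right (volume : Measure ℝ) x).setIntegral_preimage_emb
      (measurableEmbedding_addRight x) (expPowDensity p) (Ioi x)
    simpa using this.symm
  have h2 : ∀ t ∈ Ioi (0 : ℝ),
      expPowDensity p (t + x) ≤ Real.exp (-|x| ^ p) * expPowDensity p t := by
    intro t ht
    have ht : 0 < t := ht
    have h3 := Real.add_rpow_le_rpow_add ht.le hx hp
    have h4 := (expPowConst_pos hp0).le
    simp only [expPowDensity]
    rw [mul_left_comm, ← Real.exp_add, abs_of_nonneg hx, abs_of_pos ht,
      abs_of_nonneg (add_nonneg ht.le hx)]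
    gcongr
    linarith
  have h5 : expPowConst p * expPowDensity p x = Real.exp (-|x| ^ p) := by
    simp only [expPowDensity]
    rw [mul_inv_cancel_left₀ (expPowConst_pos hp0).ne']
  rw [h1, h5]
  calc ∫ t in Ioi 0, expPowDensity p (t + x)
      ≤ ∫ t in Ioi 0, Real.exp (-|x| ^ p) * expPowDensity p t :=
        setIntegral_mono_on (hi.comp_add_right x).integrableOn (hi.const_mul _).integrableOn
          measurableSet_Ioi h2
    _ = Real.exp (-|x| ^ p) * ∫ t in Ioi 0, expPowDensity p t := integral_const_mul _ _
    _ ≤ Real.exp (-|x| ^ p) * 1 := by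
        gcongr
        rw [← integral_expPowDensity hp0]
        exact setIntegral_le_integral hi (ae_of_all _ fun t => (expPowDensity_pos hp0 t).le)
    _ = _ := mul_one _

/-- Integrate the derivative of `(f - f 0)² T`, where `T` is the tail of the measure and `T' = -ρ`;
the tail bound `T ≤ Z ρ` lets half of the left side be absorbed. -/
theorem intervalIntegral_sq_sub_le {p : ℝ} (hp : 1 ≤ p) {f : ℝ → ℝ} (hf : LocallyLipschitz f)
    (hf' : Integrable fun x => deriv f x ^ 2 * expPowDensity p x) {R : ℝ} (hR : 0 ≤ R) :
    ∫ x in 0..R, (f x - f 0) ^ 2 * expPowDensity p x ≤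
      4 * expPowConst p ^ 2 * ∫ x in 0..R, deriv f x ^ 2 * expPowDensity p x := by
  have hp0 : 0 < p := by linarith
  have hi := integrable_expPowDensity hp0
  have hc := continuous_expPowDensity hp0.le
  have hZ := expPowConst_pos hp0
  set Z := expPowConst p
  set T : ℝ → ℝ := fun x => (∫ t in Ioi 0, expPowDensity p t) - ∫ t in 0..x, expPowDensity p t
    with hT
  have hT1 : ∀ x, T x = ∫ t in Ioi x, expPowDensity p t := by
    intro x
    have := intervalIntegral.integral_Ioi_sub_Ioi' (a := 0) (b := x) hi.integrableOn hi.integrableOn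
    simp only [hT]
    linarith
  have hT0 : ∀ x, 0 ≤ T x := fun x => by
    rw [hT1]
    exact setIntegral_nonneg measurableSet_Ioi fun t _ => (expPowDensity_pos hp0 t).le
  have hTd : ∀ x, HasDerivAt T (-expPowDensity p x) x := fun x =>
    (hc.integral_hasStrictDerivAt 0 x).hasDerivAt.const_sub _
  have hTac : AbsolutelyContinuousOnInterval T 0 R := by
    refine LocallyLipschitz.absolutelyContinuousOnInterval (ContDiff.locallyLipschitz (𝕂 := ℝ) ?_) _ _
    rw [contDiff_one_iff_deriv]
    refine ⟨fun x => (hTd x).differentiableAt, ?_⟩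
    rw [show deriv T = fun x => -expPowDensity p x from funext fun x => (hTd x).deriv]
    exact hc.neg
  have hv : AbsolutelyContinuousOnInterval (fun x => f x - f 0) 0 R :=
    (hf.sub (LocallyLipschitz.const (f 0))).absolutelyContinuousOnInterval _ _
  have hv2 : AbsolutelyContinuousOnInterval (fun x => (f x - f 0) ^ 2) 0 R := by
    simpa only [pow_two] using hv.fun_mul hv
  have hm := hv2.fun_mul hTac
  have h1 := hm.integral_deriv_eq_sub
  -- The boundary term vanishes at `0`, since `f - f 0` does, and is nonnegative at `R`.
  have h2 : 0 ≤ ∫ x in 0..R, deriv (fun x => (f x - f 0) ^ 2 * T x) x := by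
    rw [h1]
    simpa using mul_nonneg (sq_nonneg (f R - f 0)) (hT0 R)
  have hfc := hf.continuous
  have hI1 : IntervalIntegrable (fun x => (f x - f 0) ^ 2 * expPowDensity p x) volume 0 R :=
    Continuous.intervalIntegrable (by fun_prop) _ _
  have hI2 : IntervalIntegrable (fun x => deriv f x ^ 2 * expPowDensity p x) volume 0 R :=
    hf'.intervalIntegrable
  have h3 : ∫ x in 0..R, deriv (fun x => (f x - f 0) ^ 2 * T x) x ≤
      ∫ x in 0..R, (2 * Z ^ 2 * (deriv f x ^ 2 * expPowDensity p x)
        - 1 / 2 * ((f x - f 0) ^ 2 * expPowDensity p x)) := by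
    refine intervalIntegral.integral_mono_ae_restrict hR hm.intervalIntegrable_deriv
      ((hI2.const_mul _).sub (hI1.const_mul _)) ?_
    refine (ae_restrict_iff' measurableSet_Icc).2 ?_
    filter_upwards [hf.ae_differentiableAt] with x hx hxR
    have hd : HasDerivAt (fun x => (f x - f 0) ^ 2 * T x)
        (2 * (f x - f 0) * deriv f x * T x - (f x - f 0) ^ 2 * expPowDensity p x) x := by
      convert! ((hx.hasDerivAt.sub_const (f 0)).pow 2).mul (hTd x) using 1
      simp only [Pi.pow_apply]
      ring
    rw [hd.deriv]
    have hle : T x ≤ Z * expPowDensity p x := by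
      rw [hT1]; exact setIntegral_Ioi_expPowDensity_le hp hxR.1
    have hρ := (expPowDensity_pos hp0 x).le
    -- The weight `1 / (2 Z)` becomes `1 / 2` after multiplication by `T ≤ Z ρ`.
    have h4 : 2 * (f x - f 0) * deriv f x ≤ (1 / (2 * Z)) * (f x - f 0) ^ 2
        + 2 * Z * deriv f x ^ 2 := by
      have : (1 / (2 * Z)) * (f x - f 0) ^ 2 + 2 * Z * deriv f x ^ 2
          - 2 * (f x - f 0) * deriv f x
          = (1 / (2 * Z)) * ((f x - f 0) - 2 * Z * deriv f x) ^ 2 := by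
        field_simp; ring
      have h5 : 0 ≤ (1 / (2 * Z)) * ((f x - f 0) - 2 * Z * deriv f x) ^ 2 := by positivity
      linarith
    have h6 : 2 * (f x - f 0) * deriv f x * T x ≤
        ((1 / (2 * Z)) * (f x - f 0) ^ 2 + 2 * Z * deriv f x ^ 2) * (Z * expPowDensity p x) :=
      (mul_le_mul_of_nonneg_right h4 (hT0 x)).trans
        (mul_le_mul_of_nonneg_left hle (by positivity))
    have h7 : ((1 / (2 * Z)) * (f x - f 0) ^ 2 + 2 * Z * deriv f x ^ 2) * (Z * expPowDensity p x)
        = 1 / 2 * ((f x - f 0) ^ 2 * expPowDensity p x)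
          + 2 * Z ^ 2 * (deriv f x ^ 2 * expPowDensity p x) := by
      field_simp
    show _ ≤ _
    linarith
  rw [intervalIntegral.integral_sub (hI2.const_mul _) (hI1.const_mul _),
    intervalIntegral.integral_const_mul, intervalIntegral.integral_const_mul] at h3
  linarith

/-- A Hardy inequality for `expPowMeasure p`, centred at the origin. -/
theorem integral_sq_sub_le {p : ℝ} (hp : 1 ≤ p) {f : ℝ → ℝ} (hf : LocallyLipschitz f)
    (hf' : Integrable fun x => deriv f x ^ 2 * expPowDensity p x) :
    (Integrable fun x => (f x - f 0) ^ 2 * expPowDensity p x) ∧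
    ∫ x, (f x - f 0) ^ 2 * expPowDensity p x ≤
      4 * expPowConst p ^ 2 * ∫ x, deriv f x ^ 2 * expPowDensity p x := by
  have hp0 : 0 < p := by linarith
  have hfc := hf.continuous
  have hc := continuous_expPowDensity hp0.le
  have hρ := fun x => (expPowDensity_pos hp0 x).le
  refine integrable_and_integral_le_of_forall_symm (by fun_prop)
    (fun x => mul_nonneg (sq_nonneg _) (hρ x)) fun R hR => ?_
  -- The density is even, so the negative half-line follows by reflection.
  have hneg : LocallyLipschitz fun x => f (-x) := hf.comp LocallyLipschitz.id.neg
  have hd : ∀ x, deriv (fun x => f (-x)) x ^ 2 * expPowDensity p x =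
      (fun x => deriv f x ^ 2 * expPowDensity p x) (-x) := fun x => by
    simp only [deriv_comp_neg, expPowDensity_neg, neg_sq]
  have h1 := intervalIntegral_sq_sub_le hp hf hf' hR
  have h2 := intervalIntegral_sq_sub_le hp hneg (by simpa only [hd] using hf'.comp_neg) hR
  simp only [hd] at h2
  rw [intervalIntegral.integral_comp_neg (fun x => deriv f x ^ 2 * expPowDensity p x),
    neg_zero] at h2
  have h3 : ∫ x in 0..R, (f (-x) - f 0) ^ 2 * expPowDensity p x =
      ∫ x in (-R)..0, (f x - f 0) ^ 2 * expPowDensity p x := by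
    rw [← neg_zero, ← intervalIntegral.integral_comp_neg, neg_zero]
    simp only [expPowDensity_neg]
  rw [h3] at h2
  have hI : ∀ a b, IntervalIntegrable (fun x => (f x - f 0) ^ 2 * expPowDensity p x) volume a b :=
    Continuous.intervalIntegrable (by fun_prop)
  rw [← intervalIntegral.integral_add_adjacent_intervals (hI (-R) 0) (hI 0 R)]
  have h4 := intervalIntegral.integral_add_adjacent_intervals (a := -R) (b := 0) (c := R)
    hf'.intervalIntegrable hf'.intervalIntegrable
  have h5 : ∫ x in (-R)..R, deriv f x ^ 2 * expPowDensity p x ≤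
      ∫ x, deriv f x ^ 2 * expPowDensity p x := by
    rw [intervalIntegral.integral_of_le (by linarith)]
    exact setIntegral_le_integral hf' (ae_of_all _ fun x => mul_nonneg (sq_nonneg _) (hρ x))
  rw [← h4] at h5
  have h6 := mul_le_mul_of_nonneg_left h5 (show 0 ≤ 4 * expPowConst p ^ 2 by positivity)
  linarith

end Hardy

/-! ### Moment bound, sup bound and defective inequality. -/

section EntropyBound

open Set Filter Topology

theorem deriv_mul_expPowDensity {p : ℝ} (hp : 1 < p) {u : ℝ → ℝ} {x : ℝ}
    (hu : DifferentiableAt ℝ u x) : deriv (fun x => u x * expPowDensity p x) x =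
      deriv u x * expPowDensity p x - p * |x| ^ (p - 2) * x * (u x * expPowDensity p x) := by
  rw [(hu.hasDerivAt.fun_mul (hasDerivAt_expPowDensity hp x)).deriv]
  ring

theorem abs_rpow_le_one_add {a b : ℝ} (ha : 0 ≤ a) (hab : a ≤ b) (x : ℝ) :
    |x| ^ a ≤ 1 + |x| ^ b := by
  rcases le_total |x| 1 with h | h
  · linarith [Real.rpow_le_one (abs_nonneg x) h ha, Real.rpow_nonneg (abs_nonneg x) b]
  · linarith [Real.rpow_le_rpow_of_exponent_le h hab]

/-- If `a |u'| ≤ (a ^ s / s) u + K` for all `a ≥ 0`, then integration by parts bounds the moment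
`∫ |x| ^ p u dμ_p`. -/
theorem integral_abs_rpow_mul_le {p s : ℝ} (hs : 1 < s) (hsp : s ≤ p) {u K : ℝ → ℝ}
    (hu : LocallyLipschitz u) (hu0 : ∀ x, 0 ≤ u x) (hK0 : ∀ x, 0 ≤ K x)
    (hui : Integrable fun x => u x * expPowDensity p x)
    (hKi : Integrable fun x => K x * expPowDensity p x)
    (hd : ∀ᵐ x, ∀ a : ℝ, 0 ≤ a → a * |deriv u x| ≤ a ^ s / s * u x + K x) :
    (Integrable fun x => |x| ^ p * (u x * expPowDensity p x)) ∧
    ∫ x, |x| ^ p * (u x * expPowDensity p x) ≤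
      (1 - s⁻¹)⁻¹ * (2 * (∫ x, u x * expPowDensity p x) + ∫ x, K x * expPowDensity p x) := by
  have hp : 1 < p := hs.trans_le hsp
  have hp0 : 0 < p := by linarith
  have hρ := expPowDensity_pos hp0
  have hc := continuous_expPowDensity hp0.le
  have huc := hu.continuous
  have hpc : Continuous fun x : ℝ => |x| ^ p := continuous_abs.rpow_const fun _ => Or.inr hp0.le
  have hs1 : s⁻¹ < 1 := inv_lt_one_of_one_lt₀ hs
  have hs0 : 0 < s⁻¹ := inv_pos.2 (by linarith)
  set c := 1 - s⁻¹ with hcdef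
  have hcpos : 0 < c := by linarith
  refine integrable_and_integral_le_of_forall_symm (by fun_prop)
    (fun x => mul_nonneg (by positivity) (mul_nonneg (hu0 x) (hρ x).le)) fun R hR => ?_
  have hac : AbsolutelyContinuousOnInterval (fun x => x * (u x * expPowDensity p x)) (-R) R :=
    (LocallyLipschitz.id.absolutelyContinuousOnInterval _ _).fun_mul
      ((hu.absolutelyContinuousOnInterval _ _).fun_mul
        ((locallyLipschitz_expPowDensity hp).absolutelyContinuousOnInterval _ _))
  -- Both boundary terms of `x u ρ` have the favourable sign, because the factor `x` is odd.
  have h1 : 0 ≤ ∫ x in (-R)..R, deriv (fun x => x * (u x * expPowDensity p x)) x := by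
    rw [hac.integral_deriv_eq_sub]
    have := mul_nonneg hR (mul_nonneg (hu0 R) (hρ R).le)
    have := mul_nonneg hR (mul_nonneg (hu0 (-R)) (hρ (-R)).le)
    linarith
  have hV : IntervalIntegrable (fun x => |x| ^ p * (u x * expPowDensity p x)) volume (-R) R :=
    Continuous.intervalIntegrable (by fun_prop) _ _
  have hG : Integrable fun x => 2 * (u x * expPowDensity p x) + K x * expPowDensity p x :=
    (hui.const_mul 2).add hKi
  have h2 : ∫ x in (-R)..R, deriv (fun x => x * (u x * expPowDensity p x)) x ≤
      ∫ x in (-R)..R, ((2 * (u x * expPowDensity p x) + K x * expPowDensity p x)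
        - c * (|x| ^ p * (u x * expPowDensity p x))) := by
    refine intervalIntegral.integral_mono_ae (by linarith) hac.intervalIntegrable_deriv
      (hG.intervalIntegrable.sub (hV.const_mul c)) ?_
    filter_upwards [hu.ae_differentiableAt, hd] with x hx hdx
    have h3 : DifferentiableAt ℝ (fun x => u x * expPowDensity p x) x :=
      hx.mul (hasDerivAt_expPowDensity hp x).differentiableAt
    have h4 : deriv (fun x => x * (u x * expPowDensity p x)) x = u x * expPowDensity p x
        + x * deriv u x * expPowDensity p x - p * |x| ^ p * (u x * expPowDensity p x) := by
      have := ((hasDerivAt_id x).fun_mul h3.hasDerivAt).deriv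
      rw [deriv_mul_expPowDensity hp hx] at this
      rw [← abs_rpow_sub_two_mul_sq hp0 x]
      convert! this using 1
      simp only [id]; ring
    -- The Young condition is used with `a = |x|`; `s ≤ p` enters through `|x| ^ s ≤ 1 + |x| ^ p`.
    -- The resulting coefficient `s⁻¹` of `|x| ^ p u` is beaten by the `p` coming from `ρ'`, with
    -- margin at least `c = 1 - s⁻¹`.
    have h5 : x * deriv u x ≤ (1 + |x| ^ p) * s⁻¹ * u x + K x := by
      have h6 := hdx |x| (abs_nonneg x)
      rw [← abs_mul] at h6
      have h7 : |x| ^ s / s * u x ≤ (1 + |x| ^ p) * s⁻¹ * u x := by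
        rw [div_eq_mul_inv]
        have := abs_rpow_le_one_add (by linarith) hsp x
        have := hu0 x
        gcongr
      linarith [le_abs_self (x * deriv u x)]
    have h6 := mul_le_mul_of_nonneg_right h5 (hρ x).le
    have h7 : 0 ≤ (p - 1) * (|x| ^ p * (u x * expPowDensity p x)) :=
      mul_nonneg (by linarith) (mul_nonneg (by positivity) (mul_nonneg (hu0 x) (hρ x).le))
    have h8 : 0 ≤ c * (u x * expPowDensity p x) :=
      mul_nonneg hcpos.le (mul_nonneg (hu0 x) (hρ x).le)
    rw [h4]
    have h9 : s⁻¹ = 1 - c := by rw [hcdef]; ring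
    rw [h9] at h6
    show _ ≤ _
    linarith
  rw [intervalIntegral.integral_sub hG.intervalIntegrable (hV.const_mul c),
    intervalIntegral.integral_const_mul] at h2
  have h3 : ∫ x in (-R)..R, (2 * (u x * expPowDensity p x) + K x * expPowDensity p x) ≤
      2 * (∫ x, u x * expPowDensity p x) + ∫ x, K x * expPowDensity p x := by
    rw [← integral_const_mul, ← integral_add (hui.const_mul 2) hKi,
      intervalIntegral.integral_of_le (by linarith)]
    refine setIntegral_le_integral hG (ae_of_all _ fun x => ?_)
    exact add_nonneg (mul_nonneg zero_le_two (mul_nonneg (hu0 x) (hρ x).le))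
      (mul_nonneg (hK0 x) (hρ x).le)
  rw [inv_mul_eq_div, le_div_iff₀' hcpos]
  linarith

/-- A nonnegative absolutely continuous function is bounded by its integral plus the integral of
its derivative. -/
theorem le_integral_add_integral {F G : ℝ → ℝ} (hF : LocallyLipschitz F) (hF0 : ∀ x, 0 ≤ F x)
    (hFi : Integrable F) (hGi : Integrable G) (hFG : ∀ᵐ x, |deriv F x| ≤ G x) (x : ℝ) :
    F x ≤ (∫ y, F y) + ∫ y, G y := by
  have hG0 : 0 ≤ᵐ[volume] G := hFG.mono fun y hy => (abs_nonneg _).trans hy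
  -- `F` drops by at most `∫ G` to the right of `x`; averaging over the unit interval `[x, x + 1]`
  -- then gives the claim.
  have h1 : ∀ y ∈ Icc x (x + 1), F x - ∫ y, G y ≤ F y := by
    intro y hy
    have hac := hF.absolutelyContinuousOnInterval x y
    have h2 := hac.integral_deriv_eq_sub
    have h3 : -∫ t in x..y, deriv F t ≤ ∫ t in x..y, G t := by
      rw [← intervalIntegral.integral_neg]
      exact intervalIntegral.integral_mono_ae hy.1 hac.intervalIntegrable_deriv.neg
        hGi.intervalIntegrable (hFG.mono fun t ht => (neg_le_abs _).trans ht)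
    have h4 : ∫ t in x..y, G t ≤ ∫ t, G t := by
      rw [intervalIntegral.integral_of_le hy.1]
      exact setIntegral_le_integral hGi hG0
    linarith
  have h5 : ∫ _ in x..(x + 1), (F x - ∫ y, G y) ≤ ∫ y in x..(x + 1), F y :=
    intervalIntegral.integral_mono_on (by linarith) intervalIntegrable_const
      hFi.intervalIntegrable h1
  have h6 : ∫ y in x..(x + 1), F y ≤ ∫ y, F y := by
    rw [intervalIntegral.integral_of_le (by linarith)]
    exact setIntegral_le_integral hFi (ae_of_all _ hF0)
  simp only [intervalIntegral.integral_const, add_sub_cancel_left, one_smul] at h5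
  linarith

theorem sub_one_le_mul_log {y : ℝ} (hy : 0 ≤ y) : y - 1 ≤ y * Real.log y := by
  rcases hy.eq_or_lt with rfl | hy
  · simp
  · have := mul_le_mul_of_nonneg_left (Real.one_sub_inv_le_log_of_pos hy) hy.le
    rwa [mul_sub, mul_one, mul_inv_cancel₀ hy.ne'] at this

/-- Take logarithms in `y ρ(x) ≤ M`, using `log t ≤ t`: then `log y ≤ M - log ρ(x)`. -/
theorem mul_log_le_of_mul_expPowDensity_le {p : ℝ} (hp : 0 < p) {y x M : ℝ} (hy : 0 ≤ y)
    (hM : y * expPowDensity p x ≤ M) :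
    y * Real.log y ≤ y * (M + |x| ^ p + |Real.log (expPowConst p)|) := by
  rcases hy.eq_or_lt with rfl | hy
  · simp
  have hρ := expPowDensity_pos hp x
  have h1 : Real.log (y * expPowDensity p x) ≤ M := (Real.log_le_self (by positivity)).trans hM
  rw [Real.log_mul hy.ne' hρ.ne', expPowDensity, Real.log_mul
    (inv_pos.2 (expPowConst_pos hp)).ne' (Real.exp_pos _).ne', Real.log_exp, Real.log_inv] at h1
  gcongr
  linarith [le_abs_self (Real.log (expPowConst p))]

/-- A defective modified logarithmic Sobolev inequality, for functions of mass at most one. -/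
theorem exists_integral_mul_log_le {p s : ℝ} (hs : 1 < s) (hsp : s ≤ p) :
    ∃ A : ℝ, 0 ≤ A ∧ ∀ u K : ℝ → ℝ, LocallyLipschitz u → (∀ x, 0 ≤ u x) → (∀ x, 0 ≤ K x) →
      (Integrable fun x => u x * expPowDensity p x) → ∫ x, u x * expPowDensity p x ≤ 1 →
      (Integrable fun x => K x * expPowDensity p x) →
      (∀ᵐ x, ∀ a : ℝ, 0 ≤ a → a * |deriv u x| ≤ a ^ s / s * u x + K x) →
      (Integrable fun x => u x * Real.log (u x) * expPowDensity p x) ∧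
      ∫ x, u x * Real.log (u x) * expPowDensity p x ≤
        A * ((∫ x, u x * expPowDensity p x) + ∫ x, K x * expPowDensity p x) := by
  have hp : 1 < p := hs.trans_le hsp
  have hp0 : 0 < p := by linarith
  have hρ := expPowDensity_pos hp0
  have hc := continuous_expPowDensity hp0.le
  have hs1 : s⁻¹ < 1 := inv_lt_one_of_one_lt₀ hs
  have hs0 : 0 < s⁻¹ := inv_pos.2 (by linarith)
  set L := |Real.log (expPowConst p)|
  set c := (1 - s⁻¹)⁻¹
  have hc0 : 0 < c := inv_pos.2 (by linarith)
  refine ⟨(2 + p) + (p + 1) * (2 * c) + L, by positivity, ?_⟩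
  intro u K hu hu0 hK0 hui hu1 hKi hd
  obtain ⟨hVi, hV⟩ := integral_abs_rpow_mul_le hs hsp hu hu0 hK0 hui hKi hd
  set U := ∫ x, u x * expPowDensity p x
  set k := ∫ x, K x * expPowDensity p x
  set W := ∫ x, |x| ^ p * (u x * expPowDensity p x)
  have hU0 : 0 ≤ U := integral_nonneg fun x => mul_nonneg (hu0 x) (hρ x).le
  have hk0 : 0 ≤ k := integral_nonneg fun x => mul_nonneg (hK0 x) (hρ x).le
  have hW0 : 0 ≤ W :=
    integral_nonneg fun x => mul_nonneg (by positivity) (mul_nonneg (hu0 x) (hρ x).le)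
  have hF : LocallyLipschitz fun x => u x * expPowDensity p x :=
    (ContDiff.locallyLipschitz (𝕂 := ℝ) (f := fun z : ℝ × ℝ => z.1 * z.2) (by fun_prop)).comp
      (hu.prodMk (locallyLipschitz_expPowDensity hp))
  have hKu : Integrable fun x =>
      K x * expPowDensity p x + (1 + p) * (u x * expPowDensity p x) := hKi.add (hui.const_mul _)
  have hGi : Integrable fun x => (K x * expPowDensity p x + (1 + p) * (u x * expPowDensity p x))
      + p * (|x| ^ p * (u x * expPowDensity p x)) :=
    hKu.add (hVi.const_mul _)
  have hM := le_integral_add_integral hF (fun x => mul_nonneg (hu0 x) (hρ x).le) hui hGi (by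
    filter_upwards [hu.ae_differentiableAt, hd] with x hx hdx
    rw [deriv_mul_expPowDensity hp hx]
    -- The Young condition with `a = 1`.
    have h1 : |deriv u x| ≤ u x + K x := by
      have := hdx 1 zero_le_one
      rw [Real.one_rpow, one_mul, one_div] at this
      have := mul_le_mul_of_nonneg_right hs1.le (hu0 x)
      linarith
    have h2 : |(|x| ^ (p - 2) * x)| ≤ 1 + |x| ^ p := by
      rw [abs_mul, abs_of_nonneg (by positivity : 0 ≤ |x| ^ (p - 2))]
      rcases eq_or_ne x 0 with rfl | hx0
      · simp; positivity
      · have hx' := abs_pos.2 hx0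
        have : |x| ^ (p - 2) * |x| = |x| ^ (p - 1) := by
          rw [← Real.rpow_add_one hx'.ne']; ring_nf
        rw [this]
        exact abs_rpow_le_one_add (by linarith) (by linarith) x
    have h3 : |deriv u x * expPowDensity p x| ≤ (u x + K x) * expPowDensity p x := by
      rw [abs_mul, abs_of_pos (hρ x)]
      exact mul_le_mul_of_nonneg_right h1 (hρ x).le
    have h4 : |p * |x| ^ (p - 2) * x * (u x * expPowDensity p x)| ≤
        p * (1 + |x| ^ p) * (u x * expPowDensity p x) := by
      have h5 : 0 ≤ u x * expPowDensity p x := mul_nonneg (hu0 x) (hρ x).le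
      rw [abs_mul, abs_of_nonneg h5, mul_assoc p, abs_mul, abs_of_pos hp0]
      gcongr
    have h5 := abs_sub (deriv u x * expPowDensity p x)
      (p * |x| ^ (p - 2) * x * (u x * expPowDensity p x))
    linarith)
  rw [integral_add hKu (hVi.const_mul _),
    integral_add hKi (hui.const_mul _), integral_const_mul, integral_const_mul] at hM
  set M := U + (k + (1 + p) * U + p * W) with hMdef
  have hM0 : 0 ≤ M := by positivity
  have hub : ∀ x, u x * Real.log (u x) * expPowDensity p x ≤
      (M + L) * (u x * expPowDensity p x) + |x| ^ p * (u x * expPowDensity p x) := fun x => by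
    have := mul_le_mul_of_nonneg_right
      (mul_log_le_of_mul_expPowDensity_le hp0 (hu0 x) (hM x)) (hρ x).le
    linarith
  have hUi : Integrable fun x =>
      (M + L) * (u x * expPowDensity p x) + |x| ^ p * (u x * expPowDensity p x) :=
    (hui.const_mul _).add hVi
  have hint : Integrable fun x => u x * Real.log (u x) * expPowDensity p x := by
    refine (hUi.add (integrable_expPowDensity hp0)).mono'
      (((Real.continuous_mul_log.comp hu.continuous).mul hc).aestronglyMeasurable)
      (ae_of_all _ fun x => ?_)
    have h1 := mul_le_mul_of_nonneg_right (sub_one_le_mul_log (hu0 x)) (hρ x).le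
    have h2 : 0 ≤ u x * expPowDensity p x := mul_nonneg (hu0 x) (hρ x).le
    have h3 : 0 ≤ (M + L) * (u x * expPowDensity p x) + |x| ^ p * (u x * expPowDensity p x) := by
      positivity
    rw [Real.norm_eq_abs, abs_le]
    constructor
    · simp only [Pi.add_apply]; linarith
    · simp only [Pi.add_apply]; linarith [hub x, (hρ x).le]
  refine ⟨hint, (integral_mono hint hUi hub).trans ?_⟩
  rw [integral_add (hui.const_mul _) hVi, integral_const_mul]
  -- Mass at most one makes the quadratic term `M U` linear in `U`, `k` and `W`.
  have h1 : M * U ≤ M := mul_le_of_le_one_right hM0 hu1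
  have h2 : 0 ≤ L * k := by positivity
  have h3 : 0 ≤ (1 + p) * k := by positivity
  have h4 : (p + 1) * W ≤ (p + 1) * (c * (2 * U + k)) := by gcongr
  have h5 : 0 ≤ (p + 1) * c * k := by positivity
  show (M + L) * U + W ≤ _
  linarith
end EntropyBound

/-! ### Smooth truncation of `f²` and its Young condition. -/

section Truncation

open Set Filter Topology

theorem LocallyLipschitz.comp_of_contDiffAt {g φ : ℝ → ℝ} (hg : LocallyLipschitz g)
    (hφ : ∀ x, ContDiffAt ℝ 1 φ (g x)) : LocallyLipschitz fun x => φ (g x) := by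
  intro x
  obtain ⟨K, t, ht, hK⟩ := (hφ x).exists_lipschitzOnWith
  obtain ⟨K', t', ht', hK'⟩ := hg x
  exact ⟨K * K', t' ∩ g ⁻¹' t, inter_mem ht' (hg.continuous.continuousAt ht),
    hK.comp (hK'.mono inter_subset_left) fun y hy => hy.2⟩

/-- A smooth truncation of the identity: it vanishes for `y ≤ 4`, and is comparable with `y` for
large `y`. -/
noncomputable def smoothTrunc (k : ℕ) (y : ℝ) : ℝ := max y 4 * (1 - 4 / max y 4) ^ k

theorem smoothTrunc_of_le {k : ℕ} (hk : k ≠ 0) {y : ℝ} (hy : y ≤ 4) : smoothTrunc k y = 0 := by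
  simp [smoothTrunc, max_eq_right hy, hk]

theorem smoothTrunc_of_ge {k : ℕ} {y : ℝ} (hy : 4 ≤ y) :
    smoothTrunc k y = y * (1 - 4 / y) ^ k := by
  simp [smoothTrunc, max_eq_left hy]

theorem one_sub_four_div_mem {z : ℝ} (hz : 4 ≤ z) : 0 ≤ 1 - 4 / z ∧ 1 - 4 / z ≤ 1 := by
  have h1 : 4 / z ≤ 1 := (div_le_one (by linarith)).2 hz
  have h2 : 0 ≤ 4 / z := by positivity
  constructor <;> linarith

theorem smoothTrunc_nonneg (k : ℕ) (y : ℝ) : 0 ≤ smoothTrunc k y := by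
  have h4 : (4 : ℝ) ≤ max y 4 := le_max_right _ _
  exact mul_nonneg (by linarith) (pow_nonneg (one_sub_four_div_mem h4).1 _)

theorem smoothTrunc_le {k : ℕ} (hk : k ≠ 0) {y : ℝ} (hy : 0 ≤ y) : smoothTrunc k y ≤ y := by
  rcases le_total y 4 with h | h
  · rwa [smoothTrunc_of_le hk h]
  · rw [smoothTrunc_of_ge h]
    exact mul_le_of_le_one_right hy
      (pow_le_one₀ (one_sub_four_div_mem h).1 (one_sub_four_div_mem h).2)

theorem smoothTrunc_sq_le {k : ℕ} (hk : k ≠ 0) {s : ℝ} (hs : 0 ≤ s) :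
    smoothTrunc k (s ^ 2) ≤ 4 * (s - 1) ^ 2 := by
  rcases le_total s 2 with h | h
  · rw [smoothTrunc_of_le hk (by nlinarith)]
    positivity
  · exact (smoothTrunc_le hk (by positivity)).trans (by nlinarith)

theorem locallyLipschitz_smoothTrunc (k : ℕ) : LocallyLipschitz (smoothTrunc k) := by
  refine LocallyLipschitz.comp_of_contDiffAt (g := fun y => max y 4)
    (φ := fun z => z * (1 - 4 / z) ^ k) (LocallyLipschitz.id.max (LocallyLipschitz.const 4))
    fun y => ?_
  have h4 : (max y 4 : ℝ) ≠ 0 := (lt_of_lt_of_le (by norm_num) (le_max_right y 4)).ne'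
  exact contDiffAt_id.mul ((contDiffAt_const.sub (contDiffAt_const.div contDiffAt_id h4)).pow k)

theorem hasDerivAt_smoothTrunc {k : ℕ} (hk : k ≠ 0) {y : ℝ} (hy : 4 < y) :
    HasDerivAt (smoothTrunc k) ((1 - 4 / y) ^ (k - 1) * ((1 - 4 / y) + 4 * k / y)) y := by
  have hy0 : y ≠ 0 := by linarith
  have h1 : HasDerivAt (fun z : ℝ => z * (1 - 4 / z) ^ k)
      ((1 - 4 / y) ^ (k - 1) * ((1 - 4 / y) + 4 * k / y)) y := by
    have h2 := (hasDerivAt_id y).fun_mul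
      ((((hasDerivAt_inv hy0).const_mul 4).const_sub 1).fun_pow k)
    simp only [id, ← div_eq_mul_inv] at h2
    convert! h2 using 1
    rw [← pow_sub_one_mul hk (1 - 4 / y)]
    field_simp
  refine h1.congr_of_eventuallyEq ?_
  filter_upwards [lt_mem_nhds hy] with z hz using smoothTrunc_of_ge hz.le

/-- The left side vanishes to second order at `s = 1`, so it is quadratic for bounded `s`; for large
`s` the truncation is at least `s² / 2 ^ k`. -/
theorem sq_mul_log_sq_le {k : ℕ} (hk : k ≠ 0) {s : ℝ} (hs : 0 ≤ s) :
    s ^ 2 * Real.log (s ^ 2) - s ^ 2 + 1 ≤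
      2 ^ k * (smoothTrunc k (s ^ 2) * Real.log (smoothTrunc k (s ^ 2)))
        + (16 + 2 ^ k * (1 + 4 * k)) * (s - 1) ^ 2 := by
  have h2k : (0 : ℝ) < 2 ^ k := by positivity
  have hpos : (0 : ℝ) ≤ 2 ^ k * (1 + 4 * k) * (s - 1) ^ 2 := by positivity
  have hquad : s ^ 2 * Real.log (s ^ 2) - s ^ 2 + 1 ≤ (s + 1) ^ 2 * (s - 1) ^ 2 := by
    rcases hs.eq_or_lt with rfl | hs
    · simp
    · have := mul_le_mul_of_nonneg_left (Real.log_le_sub_one_of_pos (sq_pos_of_pos hs))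
        (sq_nonneg s)
      linarith
  rcases le_or_gt (s ^ 2) 4 with h4 | h4
  · have h2 : s ≤ 2 := by nlinarith
    rw [smoothTrunc_of_le hk h4]
    have : (s + 1) ^ 2 * (s - 1) ^ 2 ≤ 16 * (s - 1) ^ 2 := by gcongr; nlinarith
    simp only [zero_mul, mul_zero]
    linarith
  have hs2 : 2 < s := by nlinarith
  have hlow := mul_le_mul_of_nonneg_left (sub_one_le_mul_log (smoothTrunc_nonneg k (s ^ 2))) h2k.le
  have hTn := mul_nonneg h2k.le (smoothTrunc_nonneg k (s ^ 2))
  -- For `4 < s² ≤ 8` the truncated `T log T` may be negative but is at least `-1`, which a multiple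
  -- of `(s - 1)² > 1` absorbs. For `s² > 8` the factor `w = 1 - 4 / s²` is at least `1 / 2`.
  rcases le_or_gt (s ^ 2) 8 with h8 | h8
  · have h3 : s ≤ 3 := by nlinarith
    have h5 : (s + 1) ^ 2 * (s - 1) ^ 2 ≤ 16 * (s - 1) ^ 2 := by gcongr; nlinarith
    have h6 : (2 : ℝ) ^ k * 1 ≤ 2 ^ k * ((1 + 4 * k) * (s - 1) ^ 2) := by
      gcongr
      have : (1 : ℝ) ≤ 1 + 4 * k := by linarith [(Nat.cast_nonneg k : (0 : ℝ) ≤ k)]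
      nlinarith
    linarith
  · set y := s ^ 2 with hy
    have hw : 1 / 2 ≤ 1 - 4 / y := by
      have : 4 / y ≤ 1 / 2 := by rw [div_le_div_iff₀ (by linarith) (by norm_num)]; linarith
      linarith
    have hw0 : 0 < 1 - 4 / y := by linarith
    rw [smoothTrunc_of_ge h4.le]
    set w := 1 - 4 / y
    have hy0 : 0 < y := by linarith
    have hlw : -1 ≤ Real.log w := by
      have := Real.one_sub_inv_le_log_of_pos hw0
      have : w⁻¹ ≤ 2 := by rw [inv_le_comm₀ hw0 (by norm_num)]; linarith
      linarith
    have hlog : Real.log (y * w ^ k) = Real.log y + k * Real.log w := by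
      rw [Real.log_mul hy0.ne' (pow_pos hw0 k).ne', Real.log_pow w k]
    have hly : 0 ≤ Real.log y := Real.log_nonneg (by linarith)
    have hwk : 1 ≤ 2 ^ k * w ^ k := by
      rw [← mul_pow]; exact one_le_pow₀ (by linarith)
    have hwk1 : w ^ k ≤ 1 := pow_le_one₀ hw0.le (one_sub_four_div_mem h4.le).2
    have h5 : y * Real.log y ≤ 2 ^ k * (y * w ^ k) * Real.log y := by
      have := mul_le_mul_of_nonneg_right hwk (mul_nonneg hy0.le hly)
      linarith
    have h6 : Real.log y ≤ Real.log (y * w ^ k) + k := by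
      rw [hlog]
      have := mul_le_mul_of_nonneg_left hlw (Nat.cast_nonneg (α := ℝ) k)
      linarith
    have h7 : 2 ^ k * (y * w ^ k) * Real.log y ≤
        2 ^ k * (y * w ^ k) * (Real.log (y * w ^ k) + k) := by gcongr
    have h8' : 2 ^ k * (y * w ^ k) * k ≤ 2 ^ k * (4 * (s - 1) ^ 2) * k := by
      have : y * w ^ k ≤ 4 * (s - 1) ^ 2 :=
        (mul_le_of_le_one_right hy0.le hwk1).trans (by rw [hy]; nlinarith)
      gcongr
    have h9 : 0 ≤ 2 ^ k * (s - 1) ^ 2 := by positivity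
    have h10 : 0 ≤ (s - 1) ^ 2 := by positivity
    linarith

theorem modPow_nonneg (q t : ℝ) : 0 ≤ modPow q t := (sq_nonneg t).trans (le_max_left _ _)

/-- For `u = y w ^ k` with `y = f²` and `w = 1 - 4 / y`, one has `|u'| ≤ (c t / w) u` where `t =
|f'/f|` and `c = 2 (1 + k)`. Young's inequality produces `w ^ (-q)`, which `w ^ k` cancels since `k
≥ q`. -/
theorem mul_abs_deriv_smoothTrunc_le {q s : ℝ} (hqs : s.HolderConjugate q) {k : ℕ}
    (hk : q ≤ k) {f : ℝ → ℝ} {x : ℝ} (hf : DifferentiableAt ℝ f x) {a : ℝ} (ha : 0 ≤ a) :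
    a * |deriv (fun x => smoothTrunc k (f x ^ 2)) x| ≤
      a ^ s / s * smoothTrunc k (f x ^ 2) +
        (2 * (1 + k)) ^ q * (modPow q (deriv f x / f x) * f x ^ 2) := by
  have hq1 : 1 < q := hqs.symm.lt
  have hs1 : 1 < s := hqs.lt
  have hk0 : k ≠ 0 := by
    rintro rfl
    simp at hk; linarith
  have hK : 0 ≤ (2 * (1 + k) : ℝ) ^ q * (modPow q (deriv f x / f x) * f x ^ 2) :=
    mul_nonneg (by positivity) (mul_nonneg (modPow_nonneg _ _) (sq_nonneg _))
  rcases le_or_gt (f x ^ 2) 4 with h4 | h4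
  · have h0 := smoothTrunc_of_le hk0 h4
    -- Where `f² ≤ 4` the truncation attains its minimum `0`; this also covers the corner `f² = 4`.
    have hmin : IsLocalMin (fun x => smoothTrunc k (f x ^ 2)) x :=
      Eventually.of_forall fun y => by
        show smoothTrunc k (f x ^ 2) ≤ _
        rw [h0]; exact smoothTrunc_nonneg _ _
    rw [hmin.deriv_eq_zero, h0]
    simpa using hK
  have hfx : f x ≠ 0 := by
    intro h; rw [h] at h4; norm_num at h4
  have hd := (hasDerivAt_smoothTrunc hk0 h4).comp x (hf.hasDerivAt.fun_pow 2)
  rw [show (fun x => smoothTrunc k (f x ^ 2)) = smoothTrunc k ∘ fun x => f x ^ 2 from rfl, hd.deriv,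
    smoothTrunc_of_ge h4.le]
  have hw0 : 0 < 1 - 4 / f x ^ 2 := by
    have : 4 / f x ^ 2 < 1 := (div_lt_one (by linarith)).2 h4
    linarith
  have hw1 := (one_sub_four_div_mem h4.le).2
  have hfac : (1 - 4 / f x ^ 2) + 4 * k / f x ^ 2 ≤ 1 + k := by
    have : 4 * k / f x ^ 2 ≤ k := by
      rw [div_le_iff₀ (by linarith)]
      nlinarith [(Nat.cast_nonneg k : (0 : ℝ) ≤ k)]
    linarith
  set w := 1 - 4 / f x ^ 2
  have hy0 : 0 < f x ^ 2 := by linarith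
  set t := |deriv f x / f x| with ht
  have hyt : |f x| * |deriv f x| = t * f x ^ 2 := by
    rw [ht, abs_div, ← sq_abs (f x)]
    have := abs_pos.2 hfx
    field_simp
  have ht0 : 0 ≤ t := abs_nonneg _
  set c : ℝ := 2 * (1 + k) with hc
  have hc0 : 0 < c := by positivity
  have hyoung := Real.young_inequality_of_nonneg ha (b := c * t / w) (by positivity) hqs
  have h1 : a * |w ^ (k - 1) * (w + 4 * k / f x ^ 2) * (2 * f x ^ (2 - 1) * deriv f x)| ≤
      a * (c * t / w) * (f x ^ 2 * w ^ k) := by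
    have h2 : |w ^ (k - 1) * (w + 4 * k / f x ^ 2) * (2 * f x ^ (2 - 1) * deriv f x)| =
        w ^ (k - 1) * (w + 4 * k / f x ^ 2) * (2 * (t * f x ^ 2)) := by
      rw [← hyt, abs_mul, abs_of_nonneg (by positivity : 0 ≤ w ^ (k - 1) * (w + 4 * k / f x ^ 2)),
        abs_mul, abs_mul, abs_two]
      simp [mul_assoc]
    have h3 : a * (c * t / w) * (f x ^ 2 * w ^ k) =
        a * (w ^ (k - 1) * (1 + k) * (2 * (t * f x ^ 2))) := by
      rw [← pow_sub_one_mul hk0 w, hc]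
      field_simp
    rw [h2, h3]
    gcongr
  have h4' : (c * t / w) ^ q / q * (f x ^ 2 * w ^ k) ≤
      c ^ q * (modPow q (deriv f x / f x) * f x ^ 2) := by
    have h5 : (c * t / w) ^ q = c ^ q * t ^ q / w ^ q := by
      rw [Real.div_rpow (by positivity) hw0.le, Real.mul_rpow hc0.le ht0]
    have h6 : w ^ k ≤ w ^ q := by
      rw [← Real.rpow_natCast]
      exact Real.rpow_le_rpow_of_exponent_ge hw0 hw1 hk
    have h7 : t ^ q ≤ modPow q (deriv f x / f x) := le_max_right _ _
    have hwq : 0 < w ^ q := Real.rpow_pos_of_pos hw0 q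
    calc (c * t / w) ^ q / q * (f x ^ 2 * w ^ k)
        ≤ (c * t / w) ^ q / 1 * (f x ^ 2 * w ^ q) := by gcongr
      _ = c ^ q * (t ^ q * f x ^ 2) := by rw [h5]; field_simp
      _ ≤ _ := by gcongr
  have h8 := mul_le_mul_of_nonneg_right hyoung (by positivity : 0 ≤ f x ^ 2 * w ^ k)
  push_cast
  linarith

end Truncation

/-! ### Removing the defect for normalised `f`. -/

section Tightening

open Set Filter Topology

theorem measurable_modPow (q : ℝ) : Measurable (modPow q) := by
  unfold modPow
  fun_prop

theorem integrable_deriv_sq_of_modPow {p q : ℝ} (hp : 0 < p) {f : ℝ → ℝ}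
    (hE : Integrable fun x => modPow q (deriv f x / f x) * f x ^ 2 * expPowDensity p x) :
    (Integrable fun x => deriv f x ^ 2 * expPowDensity p x) ∧
    ∫ x, deriv f x ^ 2 * expPowDensity p x ≤
      ∫ x, modPow q (deriv f x / f x) * f x ^ 2 * expPowDensity p x := by
  have hρ := fun x => (expPowDensity_pos hp x).le
  have h : ∀ᵐ x, deriv f x ^ 2 * expPowDensity p x ≤
      modPow q (deriv f x / f x) * f x ^ 2 * expPowDensity p x := by
    filter_upwards [ae_deriv_eq_zero_of_eq_zero f] with x hx
    refine mul_le_mul_of_nonneg_right ?_ (hρ x)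
    by_cases h0 : f x = 0
    · simp [hx h0, h0]
    · have h1 : (deriv f x / f x) ^ 2 ≤ modPow q (deriv f x / f x) := le_max_left _ _
      calc deriv f x ^ 2 = (deriv f x / f x) ^ 2 * f x ^ 2 := by field_simp
        _ ≤ _ := by gcongr
  have hi : Integrable fun x => deriv f x ^ 2 * expPowDensity p x := by
    refine hE.mono' (((measurable_deriv f).pow_const 2).mul
      (continuous_expPowDensity hp.le).measurable).aestronglyMeasurable ?_
    filter_upwards [h] with x hx
    rwa [Real.norm_of_nonneg (mul_nonneg (sq_nonneg _) (hρ x))]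
  exact ⟨hi, integral_mono_ae hi hE h⟩

theorem integrable_sq_of_deriv_sq {p : ℝ} (hp : 1 ≤ p) {f : ℝ → ℝ} (hf : LocallyLipschitz f)
    (hf' : Integrable fun x => deriv f x ^ 2 * expPowDensity p x) :
    Integrable fun x => f x ^ 2 * expPowDensity p x := by
  have hp0 : 0 < p := by linarith
  have hρ := fun x => (expPowDensity_pos hp0 x).le
  have hfc := hf.continuous
  have hc := continuous_expPowDensity hp0.le
  refine (((integral_sq_sub_le hp hf hf').1.const_mul 2).add
    ((integrable_expPowDensity hp0).const_mul (2 * f 0 ^ 2))).mono'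
    (Continuous.aestronglyMeasurable (by fun_prop)) (ae_of_all _ fun x => ?_)
  rw [Real.norm_of_nonneg (mul_nonneg (sq_nonneg _) (hρ x))]
  have : f x ^ 2 ≤ 2 * (f x - f 0) ^ 2 + 2 * f 0 ^ 2 := by nlinarith [sq_nonneg (f x - 2 * f 0)]
  have := mul_le_mul_of_nonneg_right this (hρ x)
  simp only [Pi.add_apply]
  linarith

/-- For `f` normalised in `L ^ 2`, the Hardy inequality bounds the distance from `|f|` to `1`. -/
theorem integral_abs_sub_one_sq_le {p : ℝ} (hp : 1 ≤ p) {f : ℝ → ℝ} (hf : LocallyLipschitz f)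
    (hf' : Integrable fun x => deriv f x ^ 2 * expPowDensity p x)
    (h1 : ∫ x, f x ^ 2 * expPowDensity p x = 1) :
    (Integrable fun x => (|f x| - 1) ^ 2 * expPowDensity p x) ∧
    ∫ x, (|f x| - 1) ^ 2 * expPowDensity p x ≤
      8 * expPowConst p ^ 2 * ∫ x, deriv f x ^ 2 * expPowDensity p x := by
  have hp0 : 0 < p := by linarith
  have hρ := fun x => (expPowDensity_pos hp0 x).le
  have hfc := hf.continuous
  have hc := continuous_expPowDensity hp0.le
  have hρi := integrable_expPowDensity hp0
  have hρ1 := integral_expPowDensity hp0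
  have h2i := integrable_sq_of_deriv_sq hp hf hf'
  obtain ⟨hHi, hH⟩ := integral_sq_sub_le hp hf hf'
  have hi1 : Integrable fun x => |f x| * expPowDensity p x := by
    refine (h2i.add hρi).mono' (Continuous.aestronglyMeasurable (by fun_prop))
      (ae_of_all _ fun x => ?_)
    rw [Real.norm_of_nonneg (mul_nonneg (abs_nonneg _) (hρ x))]
    have : |f x| ≤ f x ^ 2 + 1 := by rw [← sq_abs]; nlinarith [sq_nonneg (|f x| - 1)]
    have := mul_le_mul_of_nonneg_right this (hρ x)
    simp only [Pi.add_apply]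
    linarith
  have hform : ∀ b : ℝ, (fun x => (|f x| - b) ^ 2 * expPowDensity p x) = fun x =>
      (f x ^ 2 * expPowDensity p x + b ^ 2 * expPowDensity p x)
        - 2 * b * (|f x| * expPowDensity p x) := fun b => by
    funext x
    rw [← sq_abs (f x)]; ring
  have hib : ∀ b : ℝ, Integrable fun x =>
      f x ^ 2 * expPowDensity p x + b ^ 2 * expPowDensity p x := fun b =>
    h2i.add (hρi.const_mul _)
  have hi : ∀ b : ℝ, Integrable fun x => (|f x| - b) ^ 2 * expPowDensity p x := fun b => by
    rw [hform]
    exact (hib b).sub (hi1.const_mul _)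
  set m := ∫ x, |f x| * expPowDensity p x
  have hval : ∀ b : ℝ, ∫ x, (|f x| - b) ^ 2 * expPowDensity p x = 1 + b ^ 2 - 2 * b * m :=
    fun b => by
      rw [hform, integral_sub (hib b) (hi1.const_mul _),
        integral_add h2i (hρi.const_mul _), integral_const_mul, integral_const_mul, h1, hρ1, mul_one]
  have hm0 : 0 ≤ m := integral_nonneg fun x => mul_nonneg (abs_nonneg _) (hρ x)
  have hm1 : 0 ≤ ∫ x, (|f x| - 1) ^ 2 * expPowDensity p x :=
    integral_nonneg fun x => mul_nonneg (sq_nonneg _) (hρ x)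
  have hD : ∫ x, (|f x| - |f 0|) ^ 2 * expPowDensity p x ≤
      ∫ x, (f x - f 0) ^ 2 * expPowDensity p x := by
    refine integral_mono (hi _) hHi fun x => ?_
    exact mul_le_mul_of_nonneg_right (sq_le_sq.2 (abs_abs_sub_abs_le _ _)) (hρ x)
  refine ⟨hi 1, ?_⟩
  rw [hval] at hm1 hD ⊢
  -- With `m = ∫ |f| dμ_p ∈ [0, 1]`, the quantity `1 + b² - 2 b m` is at least the variance `1 -
  -- m²`, and `2 - 2 m ≤ 2 (1 - m²)`.
  nlinarith [sq_nonneg (|f 0| - m)]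

theorem exists_integral_sq_mul_log_sq_le {p q s : ℝ} (hqs : s.HolderConjugate q) (hsp : s ≤ p) :
    ∃ C : ℝ, 0 ≤ C ∧ ∀ f : ℝ → ℝ, LocallyLipschitz f →
      ∫ x, f x ^ 2 * expPowDensity p x = 1 →
      (Integrable fun x => modPow q (deriv f x / f x) * f x ^ 2 * expPowDensity p x) →
      (Integrable fun x => f x ^ 2 * Real.log (f x ^ 2) * expPowDensity p x) ∧
      ∫ x, f x ^ 2 * Real.log (f x ^ 2) * expPowDensity p x ≤
        C * ∫ x, modPow q (deriv f x / f x) * f x ^ 2 * expPowDensity p x := by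
  obtain ⟨A, hA0, hA⟩ := exists_integral_mul_log_le hqs.lt hsp
  obtain ⟨k, hk⟩ := exists_nat_ge q
  have hq1 : 1 < q := hqs.symm.lt
  have hk0 : k ≠ 0 := by
    rintro rfl
    simp at hk; linarith
  have hp : 1 ≤ p := hqs.lt.le.trans hsp
  have hp0 : 0 < p := by linarith
  have hρ := fun x => (expPowDensity_pos hp0 x).le
  have hc := continuous_expPowDensity hp0.le
  have hρi := integrable_expPowDensity hp0
  have hρ1 := integral_expPowDensity hp0
  set Z := expPowConst p
  set c : ℝ := (2 * (1 + k)) ^ q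
  set B : ℝ := 16 + 2 ^ k * (1 + 4 * k)
  have hc0 : 0 ≤ c := by positivity
  have hB0 : 0 ≤ B := by positivity
  refine ⟨2 ^ k * A * (4 * (8 * Z ^ 2) + c) + B * (8 * Z ^ 2), by positivity, ?_⟩
  intro f hf h1 hE
  obtain ⟨hdi, hdE⟩ := integrable_deriv_sq_of_modPow hp0 hE
  obtain ⟨hPi, hP⟩ := integral_abs_sub_one_sq_le hp hf hdi h1
  have h2i := integrable_sq_of_deriv_sq hp hf hdi
  have hu : LocallyLipschitz fun x => smoothTrunc k (f x ^ 2) :=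
    (locallyLipschitz_smoothTrunc k).comp
      ((ContDiff.locallyLipschitz (𝕂 := ℝ) (f := fun z : ℝ => z ^ 2) (by fun_prop)).comp hf)
  have hu0 := fun x => smoothTrunc_nonneg k (f x ^ 2)
  have hfc := hf.continuous
  have huc := hu.continuous
  have hui : Integrable fun x => smoothTrunc k (f x ^ 2) * expPowDensity p x := by
    refine h2i.mono' (huc.mul hc).aestronglyMeasurable (ae_of_all _ fun x => ?_)
    rw [Real.norm_of_nonneg (mul_nonneg (hu0 x) (hρ x))]
    exact mul_le_mul_of_nonneg_right (smoothTrunc_le hk0 (sq_nonneg _)) (hρ x)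
  have hu1 : ∫ x, smoothTrunc k (f x ^ 2) * expPowDensity p x ≤ 1 := by
    rw [← h1]
    exact integral_mono hui h2i fun x =>
      mul_le_mul_of_nonneg_right (smoothTrunc_le hk0 (sq_nonneg _)) (hρ x)
  have huP : ∫ x, smoothTrunc k (f x ^ 2) * expPowDensity p x ≤
      4 * ∫ x, (|f x| - 1) ^ 2 * expPowDensity p x := by
    rw [← integral_const_mul]
    refine integral_mono hui (hPi.const_mul 4) fun x => ?_
    have := mul_le_mul_of_nonneg_right (smoothTrunc_sq_le hk0 (abs_nonneg (f x))) (hρ x)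
    rw [sq_abs] at this
    show _ ≤ 4 * ((|f x| - 1) ^ 2 * expPowDensity p x)
    linarith
  have hKi : Integrable fun x =>
      c * (modPow q (deriv f x / f x) * f x ^ 2) * expPowDensity p x := by
    simpa only [mul_assoc] using hE.const_mul c
  obtain ⟨hLi, hL⟩ := hA _ (fun x => c * (modPow q (deriv f x / f x) * f x ^ 2)) hu hu0
    (fun x => mul_nonneg hc0 (mul_nonneg (modPow_nonneg _ _) (sq_nonneg _))) hui hu1 hKi (by
      filter_upwards [hf.ae_differentiableAt] with x hx a ha
      exact mul_abs_deriv_smoothTrunc_le hqs hk hx ha)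
  set E := ∫ x, modPow q (deriv f x / f x) * f x ^ 2 * expPowDensity p x with hEdef
  have hKE : ∫ x, c * (modPow q (deriv f x / f x) * f x ^ 2) * expPowDensity p x = c * E := by
    rw [hEdef, ← integral_const_mul]
    simp only [mul_assoc]
  rw [hKE] at hL
  set P := ∫ x, (|f x| - 1) ^ 2 * expPowDensity p x
  have hPE : P ≤ 8 * Z ^ 2 * E := hP.trans (by gcongr)
  -- The last summand `f² ρ - ρ` integrates to zero by the normalisation.
  have hub : ∀ x, f x ^ 2 * Real.log (f x ^ 2) * expPowDensity p x ≤
      (2 ^ k * (smoothTrunc k (f x ^ 2) * Real.log (smoothTrunc k (f x ^ 2)) * expPowDensity p x)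
        + B * ((|f x| - 1) ^ 2 * expPowDensity p x))
      + (f x ^ 2 * expPowDensity p x - expPowDensity p x) := fun x => by
    have := mul_le_mul_of_nonneg_right (sq_mul_log_sq_le hk0 (abs_nonneg (f x))) (hρ x)
    rw [sq_abs] at this
    linarith
  have hi1 : Integrable fun x =>
      2 ^ k * (smoothTrunc k (f x ^ 2) * Real.log (smoothTrunc k (f x ^ 2)) * expPowDensity p x)
        + B * ((|f x| - 1) ^ 2 * expPowDensity p x) := (hLi.const_mul _).add (hPi.const_mul B)
  have hi2 : Integrable fun x => f x ^ 2 * expPowDensity p x - expPowDensity p x := h2i.sub hρi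
  have hi3 := hi1.add hi2
  have hint : Integrable fun x => f x ^ 2 * Real.log (f x ^ 2) * expPowDensity p x :=
    integrable_of_le_of_le
      (((Real.continuous_mul_log.comp (hfc.pow 2)).mul hc).aestronglyMeasurable)
      (ae_of_all _ fun x => by
        have := mul_le_mul_of_nonneg_right (sub_one_le_mul_log (sq_nonneg (f x))) (hρ x)
        show f x ^ 2 * expPowDensity p x - expPowDensity p x ≤ _
        linarith) (ae_of_all _ hub) hi2 hi3
  refine ⟨hint, (integral_mono hint hi3 hub).trans ?_⟩
  rw [integral_add' hi1 hi2, integral_add (hLi.const_mul _) (hPi.const_mul B),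
    integral_sub h2i hρi, integral_const_mul, integral_const_mul, h1, hρ1, sub_self, add_zero]
  have h3 : A * ((∫ x, smoothTrunc k (f x ^ 2) * expPowDensity p x) + c * E) ≤
      A * (4 * (8 * Z ^ 2 * E) + c * E) := by
    gcongr
    linarith
  have h4 := mul_le_mul_of_nonneg_left (hL.trans h3) (by positivity : (0 : ℝ) ≤ 2 ^ k)
  have h5 := mul_le_mul_of_nonneg_left hPE hB0
  linarith

end Tightening

/-! ### Extended-valued entropy and reduction to normalised `f`. -/

section Entropy

open Set Filter Topology

theorem entropy_eq_of_integrable {μ : Measure ℝ} {g : ℝ → ℝ} (hg : Integrable g μ)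
    (hgl : Integrable (fun x => g x * Real.log (g x)) μ) :
    entropy μ g = ((∫ x, g x * Real.log (g x) ∂μ) -
      (∫ x, g x ∂μ) * Real.log (∫ x, g x ∂μ) : ℝ) := by
  have h1 : ∫⁻ x, ENNReal.ofReal (g x * Real.log (g x)) ∂μ ≠ ⊤ := hgl.lintegral_lt_top.ne
  have h2 : ∫⁻ x, ENNReal.ofReal (-(g x * Real.log (g x))) ∂μ ≠ ⊤ := hgl.neg.lintegral_lt_top.ne
  rw [entropy, if_pos hg, integral_eq_lintegral_pos_part_sub_lintegral_neg_part hgl,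
    EReal.coe_sub, EReal.coe_sub, EReal.coe_ennreal_toReal h1, EReal.coe_ennreal_toReal h2]

/-- The negative part of `g log g` is at most `1`, so only the positive part can have infinite
integral. -/
theorem entropy_eq_top {μ : Measure ℝ} [IsProbabilityMeasure μ] {g : ℝ → ℝ} (h0 : ∀ x, 0 ≤ g x)
    (hm : Measurable g) (hgl : ¬ Integrable (fun x => g x * Real.log (g x)) μ) :
    entropy μ g = ⊤ := by
  have hm' : Measurable fun x => g x * Real.log (g x) := hm.mul hm.log
  unfold entropy
  split_ifs with hg
  · have h2 : ∫⁻ x, ENNReal.ofReal (-(g x * Real.log (g x))) ∂μ ≠ ⊤ := by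
      refine ne_top_of_le_ne_top (b := 1) (by simp) ?_
      calc ∫⁻ x, ENNReal.ofReal (-(g x * Real.log (g x))) ∂μ ≤ ∫⁻ _, 1 ∂μ := by
            refine lintegral_mono fun x => ?_
            rw [ENNReal.ofReal_le_one]
            linarith [sub_one_le_mul_log (h0 x), h0 x]
        _ = 1 := by simp
    have h1 : ∫⁻ x, ENNReal.ofReal (g x * Real.log (g x)) ∂μ = ⊤ := by
      by_contra h1
      refine hgl ⟨hm'.aestronglyMeasurable, ?_⟩
      rw [hasFiniteIntegral_iff_norm]
      refine lt_of_le_of_lt ?_ (ENNReal.add_lt_top.2 ⟨lt_top_iff_ne_top.2 h1,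
        lt_top_iff_ne_top.2 h2⟩)
      rw [← lintegral_add_left hm'.ennreal_ofReal]
      refine lintegral_mono fun x => ?_
      rcases le_total 0 (g x * Real.log (g x)) with h | h
      · rw [Real.norm_of_nonneg h]
        exact le_self_add
      · rw [Real.norm_of_nonpos h]
        exact le_add_self
    rw [h1, ← EReal.coe_ennreal_toReal h2]
    rfl
  · rfl

/-- Both sides scale by `λ²` under `f ↦ λ f`, since `f'/f` is unchanged; this reduces to norm one.
Infinite energy and `f = 0` almost everywhere are separate cases. -/
theorem modifiedLogSobolev_of_holderConjugate {p q s : ℝ} (hqs : s.HolderConjugate q)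
    (hsp : s ≤ p) : ModifiedLogSobolev (modPow q) (expPowMeasure p) := by
  obtain ⟨C, hC0, hC⟩ := exists_integral_sq_mul_log_sq_le hqs hsp
  have hp : 1 ≤ p := hqs.lt.le.trans hsp
  have hp0 : 0 < p := by linarith
  have hρ := fun x => (expPowDensity_pos hp0 x).le
  refine ⟨C + 1, by linarith, fun f hf => ?_⟩
  have hκ : ENNReal.ofReal (C + 1) ≠ 0 := by simp; linarith
  have hH0 : ∀ x, 0 ≤ modPow q (deriv f x / f x) * f x ^ 2 :=
    fun x => mul_nonneg (modPow_nonneg _ _) (sq_nonneg _)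
  have hHm : Measurable fun x => modPow q (deriv f x / f x) * f x ^ 2 :=
    ((measurable_modPow q).comp ((measurable_deriv f).div hf.continuous.measurable)).mul
      (hf.continuous.measurable.pow_const 2)
  by_cases htop : modEnergy (modPow q) (expPowMeasure p) f = ⊤
  · rw [htop, ENNReal.mul_top hκ]
    exact le_top
  have hEμ : Integrable (fun x => modPow q (deriv f x / f x) * f x ^ 2) (expPowMeasure p) := by
    refine ⟨hHm.aestronglyMeasurable, ?_⟩
    rw [hasFiniteIntegral_iff_ofReal (ae_of_all _ hH0)]
    exact lt_top_iff_ne_top.2 htop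
  have hE := (integrable_expPowMeasure_iff hp0).1 hEμ
  have henergy : modEnergy (modPow q) (expPowMeasure p) f = ENNReal.ofReal
      (∫ x, modPow q (deriv f x / f x) * f x ^ 2 * expPowDensity p x) := by
    rw [← integral_expPowMeasure hp0, ofReal_integral_eq_lintegral_ofReal hEμ (ae_of_all _ hH0)]
    rfl
  have hE0 : 0 ≤ ∫ x, modPow q (deriv f x / f x) * f x ^ 2 * expPowDensity p x :=
    integral_nonneg fun x => mul_nonneg (hH0 x) (hρ x)
  have h2i := integrable_sq_of_deriv_sq hp hf (integrable_deriv_sq_of_modPow hp0 hE).1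
  have h2μ := (integrable_expPowMeasure_iff hp0).2 h2i
  rw [henergy, ← ENNReal.ofReal_mul (by linarith), EReal.coe_ennreal_ofReal,
    max_eq_left (mul_nonneg (by linarith) hE0)]
  set N := ∫ x, f x ^ 2 ∂expPowMeasure p with hN
  have hN0 : 0 ≤ N := integral_nonneg fun x => sq_nonneg _
  rcases hN0.eq_or_lt with hN0 | hN0
  · have hz : (fun x => f x ^ 2 * Real.log (f x ^ 2)) =ᵐ[expPowMeasure p] fun _ => (0 : ℝ) := by
      have := (integral_eq_zero_iff_of_nonneg (fun x => sq_nonneg (f x)) h2μ).1 hN0.symm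
      filter_upwards [this] with x hx
      have hx : f x ^ 2 = 0 := hx
      simp [hx]
    rw [entropy_eq_of_integrable h2μ ((integrable_zero _ _ _).congr hz.symm),
      integral_congr_ae hz, ← hN, ← hN0]
    simp only [integral_zero, zero_mul, sub_zero]
    exact EReal.coe_le_coe_iff.2 (mul_nonneg (by linarith) hE0)
  · have hs0 : 0 < Real.sqrt N := Real.sqrt_pos.2 hN0
    have hsq : Real.sqrt N ^ 2 = N := Real.sq_sqrt hN0.le
    have hgf : LocallyLipschitz fun x => f x / Real.sqrt N :=
      (ContDiff.locallyLipschitz (𝕂 := ℝ) (f := fun z : ℝ => z / Real.sqrt N) (by fun_prop)).comp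
        hf
    have hquot : ∀ x, deriv (fun x => f x / Real.sqrt N) x / (f x / Real.sqrt N) =
        deriv f x / f x := fun x => by
      rw [deriv_div_const, div_div_div_cancel_right₀ hs0.ne']
    have hsqd : ∀ x, (f x / Real.sqrt N) ^ 2 = N⁻¹ * f x ^ 2 := fun x => by
      rw [div_pow, hsq, div_eq_inv_mul]
    have hE' : ∀ x, modPow q (deriv f x / f x) * (N⁻¹ * f x ^ 2) * expPowDensity p x =
        N⁻¹ * (modPow q (deriv f x / f x) * f x ^ 2 * expPowDensity p x) := fun x => by ring
    have h1 : ∫ x, N⁻¹ * f x ^ 2 * expPowDensity p x = 1 := by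
      simp only [mul_assoc]
      rw [integral_const_mul, ← integral_expPowMeasure hp0, ← hN, inv_mul_cancel₀ hN0.ne']
    obtain ⟨hLi, hL⟩ := hC _ hgf (by simpa only [hsqd] using h1) (by
      simpa only [hquot, hsqd, hE'] using hE.const_mul N⁻¹)
    simp only [hquot, hsqd, hE'] at hLi hL
    rw [integral_const_mul] at hL
    have hlog : ∀ x, f x ^ 2 * Real.log (f x ^ 2) * expPowDensity p x =
        N * (N⁻¹ * f x ^ 2 * Real.log (N⁻¹ * f x ^ 2) * expPowDensity p x) +
          Real.log N * (f x ^ 2 * expPowDensity p x) := fun x => by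
      by_cases hx : f x = 0
      · simp [hx]
      · rw [Real.log_mul (inv_ne_zero hN0.ne') (pow_ne_zero 2 hx), Real.log_inv]
        field_simp
        ring
    have hlogi : Integrable fun x => f x ^ 2 * Real.log (f x ^ 2) * expPowDensity p x := by
      simp only [hlog]
      exact (hLi.const_mul N).add (h2i.const_mul _)
    rw [entropy_eq_of_integrable h2μ ((integrable_expPowMeasure_iff hp0).2 hlogi),
      integral_expPowMeasure hp0, EReal.coe_le_coe_iff]
    simp only [hlog]
    rw [integral_add (hLi.const_mul N) (h2i.const_mul _), integral_const_mul, integral_const_mul,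
      ← integral_expPowMeasure hp0 (fun x => f x ^ 2), ← hN]
    have h3 := mul_le_mul_of_nonneg_left hL hN0.le
    rw [mul_left_comm N C, mul_inv_cancel_left₀ hN0.ne'] at h3
    linarith

end Entropy

/-! ### Failure of the inequality below the dual exponent. -/

section Counterexample

open Set Filter Topology

/-- A function of infinite entropy for `expPowMeasure p`, just at the edge of `L ^ 2`. -/
noncomputable def edgeFun (p x : ℝ) : ℝ :=
  Real.exp ((max x 1 ^ p - (1 + p) * Real.log (max x 1)) / 2)

theorem locallyLipschitz_edgeFun (p : ℝ) : LocallyLipschitz (edgeFun p) := by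
  refine LocallyLipschitz.comp_of_contDiffAt (g := fun x => max x 1)
    (φ := fun z => Real.exp ((z ^ p - (1 + p) * Real.log z) / 2))
    (LocallyLipschitz.id.max (LocallyLipschitz.const 1)) fun x => ?_
  have h1 : (max x 1 : ℝ) ≠ 0 := (lt_of_lt_of_le one_pos (le_max_right x 1)).ne'
  exact (((contDiffAt_id.rpow_const_of_ne h1).sub
    (contDiffAt_const.mul (contDiffAt_id.log h1))).div_const 2).exp

theorem edgeFun_sq (p x : ℝ) :
    edgeFun p x ^ 2 = Real.exp (max x 1 ^ p - (1 + p) * Real.log (max x 1)) := by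
  rw [edgeFun, ← Real.exp_nat_mul]
  congr 1
  push_cast
  ring

theorem edgeFun_sq_mul_density {p x : ℝ} (hx : 1 < x) :
    edgeFun p x ^ 2 * expPowDensity p x = (expPowConst p)⁻¹ * x ^ (-(1 + p)) := by
  have hx0 : 0 < x := by linarith
  rw [edgeFun_sq, expPowDensity, max_eq_left hx.le, abs_of_pos hx0, mul_left_comm, ← Real.exp_add,
    Real.rpow_def_of_pos hx0 (-(1 + p))]
  congr 2
  ring

theorem deriv_edgeFun_div {p x : ℝ} (hx : 1 < x) :
    deriv (edgeFun p) x / edgeFun p x = (p * x ^ (p - 1) - (1 + p) * x⁻¹) / 2 := by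
  have hx0 : x ≠ 0 := by linarith
  have h1 := (((Real.hasDerivAt_rpow_const (p := p) (Or.inl hx0)).sub
    ((Real.hasDerivAt_log hx0).const_mul (1 + p))).div_const 2).exp
  have h2 : edgeFun p =ᶠ[𝓝 x] fun z => Real.exp ((z ^ p - (1 + p) * Real.log z) / 2) := by
    filter_upwards [lt_mem_nhds hx] with z hz
    rw [edgeFun, max_eq_left hz.le]
  have h3 : HasDerivAt (edgeFun p) _ x := h1.congr_of_eventuallyEq h2
  rw [h3.deriv, h2.eq_of_nhds, div_eq_iff (Real.exp_pos _).ne']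
  exact mul_comm _ _

theorem deriv_edgeFun_of_lt {p x : ℝ} (hx : x < 1) : deriv (edgeFun p) x = 0 := by
  have h2 : edgeFun p =ᶠ[𝓝 x] fun _ => Real.exp ((1 ^ p - (1 + p) * Real.log 1) / 2) := by
    filter_upwards [gt_mem_nhds hx] with z hz
    rw [edgeFun, max_eq_right (le_of_lt hz)]
  rw [h2.deriv_eq, deriv_const]

theorem modPow_le_rpow {q b t : ℝ} (hq : 2 ≤ q) (hb : 1 ≤ b) (ht : |t| ≤ b) :
    modPow q t ≤ b ^ q := by
  refine max_le ?_ (Real.rpow_le_rpow (abs_nonneg _) ht (by linarith))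
  calc t ^ 2 ≤ b ^ 2 := sq_le_sq' (by linarith [neg_abs_le t]) ((le_abs_self t).trans ht)
    _ = b ^ (2 : ℝ) := (Real.rpow_two b).symm
    _ ≤ b ^ q := Real.rpow_le_rpow_of_exponent_le hb hq

theorem modPow_deriv_edgeFun_div_le {p q x : ℝ} (hq : 2 ≤ q) (hp : 1 ≤ p) (hx : 1 < x) :
    modPow q (deriv (edgeFun p) x / edgeFun p x) ≤ (1 + p) ^ q * x ^ ((p - 1) * q) := by
  have hx0 : 0 < x := by linarith
  have h1 : 1 ≤ x ^ (p - 1) := Real.one_le_rpow hx.le (by linarith)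
  have h2 : x⁻¹ ≤ 1 := inv_le_one_of_one_le₀ hx.le
  have h3 : 0 < x⁻¹ := inv_pos.2 hx0
  rw [Real.rpow_mul hx0.le, ← Real.mul_rpow (by linarith) (by linarith), deriv_edgeFun_div hx]
  refine modPow_le_rpow hq (by nlinarith) (abs_le.2 ⟨?_, ?_⟩) <;> nlinarith

theorem integrable_indicator_Ioi_rpow {a : ℝ} (ha : a < -1) (c : ℝ) :
    Integrable ((Ioi (1 : ℝ)).indicator fun x => c * x ^ a) :=
  (integrable_indicator_iff measurableSet_Ioi).2
    ((integrableOn_Ioi_rpow_of_lt ha one_pos).const_mul c)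

theorem integrable_modPow_edgeFun {p q : ℝ} (hq : 2 ≤ q) (hp : 1 ≤ p) (hpq : (p - 1) * q < p) :
    Integrable fun x =>
      modPow q (deriv (edgeFun p) x / edgeFun p x) * edgeFun p x ^ 2 * expPowDensity p x := by
  have hp0 : 0 < p := by linarith
  have hρ := fun x => (expPowDensity_pos hp0 x).le
  have hc := (locallyLipschitz_edgeFun p).continuous
  -- The exponent is below `-1` exactly when `(p - 1) q < p`.
  refine (integrable_indicator_Ioi_rpow (a := (p - 1) * q + -(1 + p)) (by linarith)
    ((1 + p) ^ q * (expPowConst p)⁻¹)).mono' ((((measurable_modPow q).comp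
      ((measurable_deriv _).div hc.measurable)).mul (hc.measurable.pow_const 2)).mul
        (continuous_expPowDensity hp0.le).measurable).aestronglyMeasurable ?_
  filter_upwards [Measure.ae_ne volume (1 : ℝ)] with x hx1
  rw [Real.norm_of_nonneg (mul_nonneg (mul_nonneg (modPow_nonneg _ _) (sq_nonneg _)) (hρ x))]
  rcases lt_or_gt_of_ne hx1 with hx | hx
  · rw [deriv_edgeFun_of_lt hx, indicator_of_notMem (by simp [hx.le])]
    simp [modPow, Real.zero_rpow (show q ≠ 0 by linarith)]
  · have hx0 : 0 < x := by linarith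
    rw [indicator_of_mem (show x ∈ Ioi (1 : ℝ) from hx), mul_assoc, edgeFun_sq_mul_density hx,
      Real.rpow_add hx0]
    have h1 : 0 ≤ (expPowConst p)⁻¹ * x ^ (-(1 + p)) :=
      mul_nonneg (inv_nonneg.2 (expPowConst_pos hp0).le) (by positivity)
    have := mul_le_mul_of_nonneg_right (modPow_deriv_edgeFun_div_le hq hp hx) h1
    linarith

theorem not_integrable_edgeFun_sq_mul_log {p : ℝ} (hp : 0 < p) :
    ¬ Integrable fun x =>
      edgeFun p x ^ 2 * Real.log (edgeFun p x ^ 2) * expPowDensity p x := by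
  intro h
  have hZ := expPowConst_pos hp
  refine not_integrableOn_Ioi_inv (a := (1 : ℝ)) ?_
  -- This dominates the logarithmic correction, via `log x ≤ x ^ (p / 2) / (p / 2)`; what remains is
  -- `1 / x`.
  have h1 : IntegrableOn (fun x : ℝ => x ^ (-(1 + p / 2))) (Ioi 1) :=
    integrableOn_Ioi_rpow_of_lt (by linarith) one_pos
  refine Integrable.mono' ((h.integrableOn.const_mul (expPowConst p)).add
    (h1.const_mul ((1 + p) / (p / 2)))) measurable_inv.aestronglyMeasurable ?_
  refine (ae_restrict_iff' measurableSet_Ioi).2 (ae_of_all _ fun x hx => ?_)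
  have hx : 1 < x := hx
  have hx0 : 0 < x := by linarith
  rw [Real.norm_of_nonneg (inv_nonneg.2 hx0.le)]
  simp only [Pi.add_apply]
  have h2 : edgeFun p x ^ 2 * Real.log (edgeFun p x ^ 2) * expPowDensity p x =
      (expPowConst p)⁻¹ * (x⁻¹ - (1 + p) * Real.log x * x ^ (-(1 + p))) := by
    rw [mul_right_comm, edgeFun_sq_mul_density hx, edgeFun_sq, Real.log_exp, max_eq_left hx.le]
    have : x⁻¹ = x ^ (-(1 + p)) * x ^ p := by
      rw [← Real.rpow_add hx0, ← Real.rpow_neg_one]; ring_nf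
    rw [this]; ring
  rw [h2, mul_inv_cancel_left₀ hZ.ne']
  have h3 := Real.log_le_rpow_div hx0.le (show 0 < p / 2 by linarith)
  have h4 : x ^ (-(1 + p / 2)) = x ^ (p / 2) * x ^ (-(1 + p)) := by
    rw [← Real.rpow_add hx0]; ring_nf
  have h5 : (1 + p) * Real.log x * x ^ (-(1 + p)) ≤
      (1 + p) * (x ^ (p / 2) / (p / 2)) * x ^ (-(1 + p)) := by gcongr
  have h6 : (1 + p) / (p / 2) * x ^ (-(1 + p / 2)) =
      (1 + p) * (x ^ (p / 2) / (p / 2)) * x ^ (-(1 + p)) := by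
    rw [h4]; ring
  linarith

theorem not_modifiedLogSobolev {p q : ℝ} (hq : 2 ≤ q) (hp : 1 ≤ p) (hpq : (p - 1) * q < p) :
    ¬ ModifiedLogSobolev (modPow q) (expPowMeasure p) := by
  rintro ⟨κ, -, hκ⟩
  have hp0 : 0 < p := by linarith
  have := isProbabilityMeasure_expPowMeasure hp0
  have h1 := hκ _ (locallyLipschitz_edgeFun p)
  rw [entropy_eq_top (fun x => sq_nonneg _)
    ((locallyLipschitz_edgeFun p).continuous.measurable.pow_const 2) (fun h =>
      not_integrable_edgeFun_sq_mul_log hp0 ((integrable_expPowMeasure_iff hp0).1 h)),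
    top_le_iff, EReal.coe_ennreal_eq_top_iff] at h1
  refine ENNReal.mul_ne_top ENNReal.ofReal_ne_top ?_ h1
  exact ((integrable_expPowMeasure_iff hp0).2
    (integrable_modPow_edgeFun hq hp hpq)).lintegral_lt_top.ne

end Counterexample

theorem mainTheorem5 (q qs p : ℝ) (hq : 2 ≤ q) (hqs : 1 / q + 1 / qs = 1) (hp : 1 ≤ p) :
    ModifiedLogSobolev (modPow q) (expPowMeasure p) ↔ qs ≤ p := by
  have hconj : q.HolderConjugate qs := Real.holderConjugate_iff.2
    ⟨by linarith, by simpa only [one_div] using hqs⟩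
  constructor
  · intro h
    by_contra! hlt
    refine not_modifiedLogSobolev hq hp ?_ h
    -- Since `(q - 1) q* = q`, the condition `p < q*` reads `(q - 1) p < q`, that is `(p - 1) q <
    -- p`.
    have h1 := hconj.sub_one_mul_conj
    nlinarith
  · exact modifiedLogSobolev_of_holderConjugate hconj.symm
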